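/- Let $n\ge 2$ and $d>2$ be integers, let $\mathbb S^{n-1}\subset\mathbb R^n$ be the Euclidean unit sphere, and for a real form $f$ of degree $d$ in $n$ variables let $\lambda_1(\nabla^2 f(x))\le\lambda_2(\nabla^2 f(x))\le\cdots$ be the eigenvalues, with multiplicity, of its Hessian at $x$. Put $$\mathcal D_f(x)=\det\begin{pmatrix}\nabla^2 f(x)-d\,f(x)\,I & x\\ x^T & 0\end{pmatrix}\in\mathbb R[x].$$ Call $f$ generic if there is no $z\in\mathbb C^n$ with $\sum_i z_i^2=1$, $\nabla f(z)=d\,f(z)\,z$ and $\mathcal D_f(z)=0$. Genericity holds outside the zero set of a nonzero polynomial: there is a nonzero real polynomial $Q$ in the coefficients of degree-$d$ forms in $n$ variables (depending only on $n$ and $d$) such that every degree-$d$ form $f$ with $Q(f)\ne 0$ is generic. A form $f$ has no spurious local minimum on $\mathbb S^{n-1}$ if every local minimizer of $f$ on $\mathbb S^{n-1}$ is a global minimizer of $f$ on $\mathbb S^{n-1}$. Let $$\Theta=\{x\in\mathbb S^{n-1}:\ \|\nabla f(x)\|=d\,|f(x)|\}.$$ Then for every generic degree-$d$ form $f$ (in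 particular whenever $Q(f)\neq0$): (i) If $f\ge 0$ on $\mathbb R^n$, then $f$ has no spurious local minimum on $\mathbb S^{n-1}$ if and only if $f$ is constant on $\{x\in\Theta:\ \lambda_1(\nabla^2 f(x))\ge\|\nabla f(x)\|\}$. (ii) If $f$ takes negative values, then $f$ has no spurious local minimum on $\mathbb S^{n-1}$ if and only if $$\{x\in\Theta:\ f(x)\ge 0,\ \lambda_1(\nabla^2 f(x))\ge\|\nabla f(x)\|\}=\emptyset$$ and $f$ is constant on $\{x\in\Theta:\ f(x)<0,\ \lambda_2(\nabla^2 f(x))\ge-\|\nabla f(x)\|\}$. -/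

import Mathlib

namespace SphereForm

open MvPolynomial

noncomputable section

/-- The Euclidean space `ℝⁿ`. -/
abbrev E (n : ℕ) : Type := EuclideanSpace ℝ (Fin n)

/-- The unit sphere of `ℝⁿ`. -/
def unitSphere (n : ℕ) : Set (E n) := Metric.sphere 0 1

/-- The polynomial function on `ℝⁿ` defined by `f`. -/
def value {n : ℕ} (f : MvPolynomial (Fin n) ℝ) (x : E n) : ℝ := eval (fun i => x i) f

/-- The gradient of `f` at `x`. -/
def grad {n : ℕ} (f : MvPolynomial (Fin n) ℝ) (x : E n) : E n :=
  WithLp.toLp 2 fun i => value (pderiv i f) x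

/-- The Hessian matrix of `f` with polynomial entries. -/
def hessPoly {n : ℕ} (f : MvPolynomial (Fin n) ℝ) :
    Matrix (Fin n) (Fin n) (MvPolynomial (Fin n) ℝ) :=
  Matrix.of fun i j => pderiv i (pderiv j f)

/-- The Hessian matrix of `f` at `x`. -/
def hess {n : ℕ} (f : MvPolynomial (Fin n) ℝ) (x : E n) : Matrix (Fin n) (Fin n) ℝ :=
  Matrix.of fun i j => value (hessPoly f i j) x

theorem pderiv_comm {n : ℕ} (i j : Fin n) (f : MvPolynomial (Fin n) ℝ) :
    pderiv i (pderiv j f) = pderiv j (pderiv i f) := by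
  have h : ⁅pderiv (R := ℝ) i, pderiv (R := ℝ) j⁆ = 0 := by
    apply MvPolynomial.derivation_ext
    intro k
    simp only [Derivation.commutator_apply, pderiv_X, Derivation.coe_zero, Pi.zero_apply]
    by_cases h1 : k = i <;> by_cases h2 : k = j <;> simp [Pi.single_apply, h1, h2]
    all_goals split_ifs <;> simp
  have h' := congrArg (fun D => D f) h
  simpa [Derivation.commutator_apply, sub_eq_zero] using h'

theorem hess_isHermitian {n : ℕ} (f : MvPolynomial (Fin n) ℝ) (x : E n) :
    (hess f x).IsHermitian := by
  ext i j
  simp [hess, hessPoly, pderiv_comm i j]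

/-- The eigenvalues, with multiplicity, of the Hessian of `f` at `x` in increasing order;
the index `0` is the smallest one (Mathlib's `eigenvalues₀` lists them in decreasing order). -/
def hessEig {n : ℕ} (f : MvPolynomial (Fin n) ℝ) (x : E n) (k : Fin n) : ℝ :=
  (hess_isHermitian f x).eigenvalues₀ (Fin.cast (Fintype.card_fin n).symm k.rev)

theorem hessEig_monotone {n : ℕ} (f : MvPolynomial (Fin n) ℝ) (x : E n) :
    Monotone (hessEig f x) := by
  intro a b hab
  apply (hess_isHermitian f x).eigenvalues₀_antitone
  simpa [Fin.le_def] using Fin.rev_le_rev.mpr hab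

/-- The bordered determinant
`det [[∇²f(x) - d f(x) I, x], [xᵀ, 0]]`, a polynomial in `x`. -/
def borderedDet {n : ℕ} (d : ℕ) (f : MvPolynomial (Fin n) ℝ) : MvPolynomial (Fin n) ℝ :=
  (Matrix.fromBlocks (hessPoly f - ((d : MvPolynomial (Fin n) ℝ) * f) • 1)
    (Matrix.replicateCol Unit fun i => (X i : MvPolynomial (Fin n) ℝ))
    (Matrix.replicateRow Unit fun i => (X i : MvPolynomial (Fin n) ℝ)) 0).det

/-- Genericity of a degree-`d` form: the equations `∂f/∂xᵢ = d f xᵢ` (for all `i`) and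
`borderedDet d f = 0` have no common complex solution on the complex quadric `∑ xᵢ² = 1`. -/
def IsGeneric {n : ℕ} (d : ℕ) (f : MvPolynomial (Fin n) ℝ) : Prop :=
  ¬ ∃ z : Fin n → ℂ, ∑ i, z i ^ 2 = 1 ∧
    (∀ i, aeval z (pderiv i f) = (d : ℂ) * aeval z f * z i) ∧
    aeval z (borderedDet d f) = 0

/-- The coefficient vector of a degree-`d` form, indexed by the monomials of degree `d`. -/
def coeffVec {n : ℕ} (d : ℕ) (f : MvPolynomial (Fin n) ℝ) :
    {m : Fin n →₀ ℕ // m.degree = d} → ℝ :=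
  fun m => f.coeff m.1

/-- Every local minimizer of `f` on the unit sphere is a global minimizer on it. -/
def NoSpuriousLocalMin {n : ℕ} (f : MvPolynomial (Fin n) ℝ) : Prop :=
  ∀ x ∈ unitSphere n, IsLocalMinOn (value f) (unitSphere n) x →
    IsMinOn (value f) (unitSphere n) x

/-- The set `Θ` of points of the sphere with `‖∇f(x)‖ = d |f(x)|`. -/
def Theta {n : ℕ} (d : ℕ) (f : MvPolynomial (Fin n) ℝ) : Set (E n) :=
  {x | x ∈ unitSphere n ∧ ‖grad f x‖ = d * |value f x|}

/-- `f` is constant on the set `S` (which may be empty). -/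
def ConstantOn {n : ℕ} (f : MvPolynomial (Fin n) ℝ) (S : Set (E n)) : Prop :=
  ∀ x ∈ S, ∀ y ∈ S, value f x = value f y

end

end SphereForm

/-!
The polynomial `Q` comes from elimination. Let `A` be the polynomial ring in the coefficients of
the generic form `F` of degree `d`, and let `I ⊆ A[z]` be generated by `∑ zᵢ² - 1`, by
`∂ᵢF - d F zᵢ`, and by the bordered determinant. Any nonzero element of `I ∩ A` serves as `Q`. If
`I ∩ A = 0`, a maximal ideal of `Frac(A)[z]` containing `I` gives a field `L` over `A` with a point
`z` satisfying all the equations (`exists_point_of_comap_span_eq_bot`). In characteristic zero `L`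
is formally smooth over `A`, so every derivation `∂/∂aₘ` of `A` extends to `L`
(`exists_derivation_extension`). Take a kernel vector `(u, t)` of the bordered matrix at `z`.
Differentiating `∇F(z) = λ z` and `∑ zᵢ² = 1` along `∂/∂aₘ` and pairing with `u`, all terms
containing derivatives of `z` and `λ` cancel, which leaves `u · ∇(xᵐ)(z) = 0` for every monomial
`xᵐ` of degree `d`. As `z ≠ 0`, this forces `u = 0` and then `t = 0`, a contradiction
(`not_forall_degeneracyEquations_genericForm`).

For the second part, equality in Cauchy-Schwarz together with Euler's identity identifies `Θ` with
the set of critical points `∇f(x) = d f(x) x` on the sphere (`mem_Theta_iff`). For `y` on the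
sphere and `h = y - x` one has `⟪x, h⟫ = -‖h‖² / 2`, so at a critical point
`f(y) - f(x) = ⟪h, (∇²f(x) - d f(x)) h⟫ / 2 + O(‖h‖³)`. Hence semidefiniteness of
`∇²f(x) - d f(x)` on the orthogonal complement of `x` is necessary for a local minimum, and
definiteness there is sufficient; for generic `f` the bordered determinant does not vanish at `x`,
so the two agree (`isLocalMinOn_iff`). Finally, `x` is an eigenvector of `∇²f(x)` with eigenvalue
`(d - 1) d f(x)`. When `f(x) ≥ 0` this is at least `d f(x)`, and semidefiniteness on the complement
says `λ₁ ≥ d f(x)`. When `f(x) < 0` it lies below `d f(x)`, and the condition becomes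
`λ₂ ≥ d f(x)`. So the sets in the theorem are the sets of local minima, and local minima are all
global iff `f` is constant on them.
-/

/-! ### Extending derivations along formally smooth algebras -/

namespace SphereForm

open MvPolynomial
noncomputable section

/-- A formally smooth `A`-algebra `L` lifts to any nilpotent thickening `B` of `L`, compatibly with
a given map `A → B`. The map `φ` is an argument, so that `B` may carry another `A`-algebra
structure. -/
theorem exists_ringHom_lift {A L B : Type*} [CommRing A] [CommRing L] [CommRing B] [Algebra A L]
    [Algebra.FormallySmooth A L] (π : B →+* L) (hπ : Function.Surjective π)
    (hker : IsNilpotent (RingHom.ker π)) (φ : A →+* B) (h : π.comp φ = algebraMap A L) :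
    ∃ ψ : L →+* B, ψ.comp (algebraMap A L) = φ ∧ π.comp ψ = RingHom.id L := by
  let := φ.toAlgebra
  let g : B →ₐ[A] L := { π with commutes' := fun a => RingHom.congr_fun h a }
  let ψ := Algebra.FormallySmooth.liftOfSurjective (AlgHom.id A L) g hπ hker
  refine ⟨ψ, ?_, ?_⟩
  · ext a; exact ψ.commutes a
  · ext x; exact Algebra.FormallySmooth.liftOfSurjective_apply (AlgHom.id A L) g hπ hker x

/-- Derivations extend along formally smooth algebras: a derivation of `A` amounts to a ring map from
`A` to the dual numbers over `L`, which lifts to `L`. -/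
theorem exists_derivation_extension {R A L : Type*} [CommRing R] [CommRing A] [CommRing L]
    [Algebra R A] [Algebra R L] [Algebra A L] [IsScalarTower R A L] [Algebra.FormallySmooth A L]
    (δ : Derivation R A A) :
    ∃ D : Derivation R L L, ∀ a, D (algebraMap A L a) = algebraMap A L (δ a) := by
  let φ : A →+* TrivSqZeroExt L L :=
    { toFun := fun a => (TrivSqZeroExt.inl (algebraMap A L a) +
        TrivSqZeroExt.inr (algebraMap A L (δ a)))
      map_one' := by ext <;> simp
      map_mul' := fun a b => by ext <;> simp [-DualNumber.inr_eq_smul_eps, mul_comm]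
      map_zero' := by ext <;> simp
      map_add' := fun a b => by ext <;> simp [-DualNumber.inr_eq_smul_eps] }
  let π : TrivSqZeroExt L L →+* L := (TrivSqZeroExt.fstHom L L L).toRingHom
  have hπ : Function.Surjective π := fun x => ⟨TrivSqZeroExt.inl x, by simp [π]⟩
  have hker : IsNilpotent (RingHom.ker π) := by
    refine ⟨2, ?_⟩
    refine (pow_two (RingHom.ker π)).trans ?_
    rw [Ideal.zero_eq_bot, eq_bot_iff, Ideal.mul_le]
    intro r hr s hs
    have hr' : r.fst = 0 := hr
    have hs' : s.fst = 0 := hs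
    rw [Ideal.mem_bot]
    ext <;> simp [hr', hs']
  obtain ⟨ψ, h1, h2⟩ := exists_ringHom_lift π hπ hker φ (by ext a; simp [φ, π])
  have hf : ∀ x, (ψ x).fst = x := fun x => RingHom.congr_fun h2 x
  have hs : ∀ a, (ψ (algebraMap A L a)).snd = algebraMap A L (δ a) := fun a => by
    have := RingHom.congr_fun h1 a
    simp only [RingHom.comp_apply] at this
    rw [this]; simp [-DualNumber.inr_eq_smul_eps, φ]
  refine ⟨Derivation.mk' { toFun := fun x => (ψ x).snd, map_add' := ?_, map_smul' := ?_ } ?_, hs⟩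
  · intro x y; simp
  · intro r x
    rw [Algebra.smul_def, IsScalarTower.algebraMap_apply R A L, map_mul, TrivSqZeroExt.snd_mul,
      hf, hs, hf]
    simp [Algebra.smul_def, IsScalarTower.algebraMap_apply R A L]
  · intro x y
    simp [hf, mul_comm]

/-- The chain rule for a derivation applied to a polynomial expression. -/
theorem derivation_aeval {R L σ : Type*} [CommRing R] [CommRing L] [Algebra R L] [Fintype σ]
    (D : Derivation R L L) (z : σ → L) (p : MvPolynomial σ R) :
    D (aeval z p) = ∑ i, aeval z (pderiv i p) * D (z i) := by
  classical
  induction p using MvPolynomial.induction_on with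
  | C a => simp [← algebraMap_eq]
  | add p q hp hq => simp [hp, hq, add_mul, Finset.sum_add_distrib]
  | mul_X p i hp =>
    simp only [map_mul, aeval_X, Derivation.leibniz, smul_eq_mul, hp, pderiv_X, map_add,
      add_mul, Finset.sum_add_distrib, Finset.mul_sum]
    congr 1
    · rw [Finset.sum_eq_single i] 
      · simp
      · intro j _ hj; simp [hj.symm]
      · simp
    · exact Finset.sum_congr rfl fun j _ => by ring

instance (n d : ℕ) : Finite {m : Fin n →₀ ℕ // m.degree = d} :=
  (Finsupp.finite_of_degree_eq d).to_subtype

instance (n d : ℕ) : Fintype {m : Fin n →₀ ℕ // m.degree = d} := Fintype.ofFinite _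

/-- The coordinate ring of the space of forms of degree `d` in `n` variables. -/
abbrev CoeffRing (n d : ℕ) : Type := MvPolynomial {m : Fin n →₀ ℕ // m.degree = d} ℝ

/-- The generic form of degree `d`, whose coefficients are indeterminates. -/
def genericForm (n d : ℕ) : MvPolynomial (Fin n) (CoeffRing n d) :=
  ∑ m : {m : Fin n →₀ ℕ // m.degree = d}, monomial m.1 (X m)

theorem map_genericForm {n d : ℕ} (f : MvPolynomial (Fin n) ℝ) (hf : f.IsHomogeneous d) :
    map (eval (coeffVec d f)) (genericForm n d) = f := by
  classical
  ext m
  simp only [genericForm, map_sum, map_monomial, eval_X, coeff_sum, coeff_monomial, coeffVec]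
  by_cases hm : m.degree = d
  · rw [Finset.sum_eq_single ⟨m, hm⟩]
    · simp
    · intro b _ hb
      rw [if_neg fun h => hb (Subtype.ext h)]
    · simp
  · rw [hf.coeff_eq_zero hm, Finset.sum_eq_zero]
    intro b _
    rw [if_neg]
    rintro rfl
    exact hm b.2

/-- The bordered matrix `[[∇²F - d F I, x], [xᵀ, 0]]` over a general coefficient ring. For
`R = ℝ` its determinant is definitionally `borderedDet d F`. -/
def borderedMatrix {n : ℕ} {R : Type*} [CommRing R] (d : ℕ) (F : MvPolynomial (Fin n) R) :
    Matrix (Fin n ⊕ Unit) (Fin n ⊕ Unit) (MvPolynomial (Fin n) R) :=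
  Matrix.fromBlocks (Matrix.of (fun i j => pderiv i (pderiv j F)) -
      ((d : MvPolynomial (Fin n) R) * F) • 1)
    (Matrix.replicateCol Unit fun i => (X i : MvPolynomial (Fin n) R))
    (Matrix.replicateRow Unit fun i => (X i : MvPolynomial (Fin n) R)) 0

/-- The polynomials whose common zeros are the degenerate critical points of `F` on the quadric
`∑ xᵢ² = 1`; a real form is generic if they have no common complex zero. -/
def degeneracyEquations {n : ℕ} {R : Type*} [CommRing R] (d : ℕ) (F : MvPolynomial (Fin n) R) :
    Set (MvPolynomial (Fin n) R) :=
  {∑ i, X i ^ 2 - 1} ∪ Set.range (fun i => pderiv i F - (d : MvPolynomial (Fin n) R) * F * X i) ∪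
    {(borderedMatrix d F).det}

theorem map_borderedMatrix {n d : ℕ} {R S : Type*} [CommRing R] [CommRing S] (φ : R →+* S)
    (F : MvPolynomial (Fin n) R) :
    (map φ).mapMatrix (borderedMatrix d F) = borderedMatrix d (map φ F) := by
  refine Matrix.ext fun i j => ?_
  rcases i with i | i <;> rcases j with j | j <;>
    simp [borderedMatrix, pderiv_map, Matrix.one_apply, apply_ite (map φ)]

theorem image_map_degeneracyEquations {n d : ℕ} {R S : Type*} [CommRing R] [CommRing S] (φ : R →+* S)
    (F : MvPolynomial (Fin n) R) :
    map φ '' degeneracyEquations d F = degeneracyEquations d (map φ F) := by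
  have h : map φ (borderedMatrix d F).det = (borderedMatrix d (map φ F)).det := by
    rw [RingHom.map_det, map_borderedMatrix]
  simp only [degeneracyEquations, Set.image_union, Set.image_singleton, h, ← Set.range_comp]
  simp [Function.comp_def, pderiv_map]

attribute [local instance] algebraMvPolynomial in
/-- If the ideal of a system of equations over a domain `R` meets `R` only in `0`, the system has a
solution in a field that is formally smooth over `R`, namely in the residue field of a maximal ideal
of the polynomial ring over `Frac R`. -/
theorem exists_point_of_comap_span_eq_bot {R σ : Type} [CommRing R] [IsDomain R] [CharZero R]
    [Finite σ] (T : Set (MvPolynomial σ R)) (hT : (Ideal.span T).comap C = ⊥) :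
    ∃ (L : Type) (_ : Field L) (_ : Algebra R L), Algebra.FormallySmooth R L ∧
      ∃ z : σ → L, ∀ p ∈ T, aeval z p = 0 := by
  let K := FractionRing R
  have : CharZero K := charZero_of_injective_algebraMap (FaithfulSMul.algebraMap_injective R K)
  let J : Ideal (MvPolynomial σ K) :=
    (Ideal.span T).map (algebraMap (MvPolynomial σ R) (MvPolynomial σ K))
  have hJ : J ≠ ⊤ := by
    rw [IsLocalization.map_algebraMap_ne_top_iff_disjoint ((nonZeroDivisors R).map (C (σ := σ)))]
    rw [Set.disjoint_left]
    rintro _ ⟨a, ha, rfl⟩ h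
    have h0 : a ∈ (Ideal.span T).comap C := h
    rw [hT, Ideal.mem_bot] at h0
    exact nonZeroDivisors.ne_zero ha h0
  obtain ⟨M, hM, hJM⟩ := Ideal.exists_le_maximal J hJ
  let := Ideal.Quotient.field M
  have hs : Algebra.FormallySmooth R K := .of_isLocalization (nonZeroDivisors R)
  have hs' : Algebra.FormallySmooth K (MvPolynomial σ K ⧸ M) := inferInstance
  refine ⟨MvPolynomial σ K ⧸ M, inferInstance, inferInstance, .comp R K _,
    fun i => Ideal.Quotient.mk M (X i), fun p hp => ?_⟩
  · have h1 : algebraMap (MvPolynomial σ R) (MvPolynomial σ K) p ∈ M :=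
      hJM (Ideal.mem_map_of_mem _ (Ideal.subset_span hp))
    rw [← Ideal.Quotient.eq_zero_iff_mem] at h1
    rw [← h1, algebraMap_def, ← aeval_map_algebraMap K]
    have : (aeval fun i => Ideal.Quotient.mk M (X i)) = Ideal.Quotient.mkₐ K M := by
      ext; simp
    rw [this]; rfl

end
end SphereForm

/-! ### The degeneracy locus of the generic form -/

namespace SphereForm

open MvPolynomial
noncomputable section

theorem genericForm_eq_sum (n d : ℕ) : genericForm n d =
    ∑ m : {m : Fin n →₀ ℕ // m.degree = d},
      C (X m) * map (algebraMap ℝ (CoeffRing n d)) (monomial m.1 (1 : ℝ)) := by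
  refine Finset.sum_congr rfl fun m _ => ?_
  rw [map_monomial, map_one, C_mul_monomial, mul_one]

theorem pderiv_genericForm {n d : ℕ} (j : Fin n) : pderiv j (genericForm n d) =
    ∑ m : {m : Fin n →₀ ℕ // m.degree = d},
      C (X m) * map (algebraMap ℝ (CoeffRing n d)) (pderiv j (monomial m.1 (1 : ℝ))) := by
  simp only [genericForm_eq_sum, map_sum, pderiv_C_mul, pderiv_map]

theorem pderiv_pderiv_genericForm {n d : ℕ} (i j : Fin n) :
    pderiv i (pderiv j (genericForm n d)) =
    ∑ m : {m : Fin n →₀ ℕ // m.degree = d},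
      C (X m) * map (algebraMap ℝ (CoeffRing n d)) (pderiv i (pderiv j (monomial m.1 (1 : ℝ)))) := by
  simp only [pderiv_genericForm, map_sum, pderiv_C_mul, pderiv_map]

theorem aeval_sum_C_mul_map {n d : ℕ} {L : Type*} [CommRing L] [Algebra ℝ L]
    [Algebra (CoeffRing n d) L] [IsScalarTower ℝ (CoeffRing n d) L] (z : Fin n → L)
    (p : {m : Fin n →₀ ℕ // m.degree = d} → MvPolynomial (Fin n) ℝ) :
    aeval z (∑ m, C (X m) * map (algebraMap ℝ (CoeffRing n d)) (p m)) =
      ∑ m, algebraMap (CoeffRing n d) L (X m) * aeval z (p m) := by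
  simp only [map_sum, map_mul, aeval_C, aeval_map_algebraMap]

/-- A vector that kills the gradients of all forms of degree `d` at a nonzero point vanishes. -/
theorem eq_zero_of_forall_monomial {n d : ℕ} (hd : 0 < d) {L : Type*} [Field L] [Algebra ℝ L]
    {z u : Fin n → L} (hz : z ≠ 0)
    (h : ∀ m : Fin n →₀ ℕ, m.degree = d →
      ∑ j, u j * aeval z (pderiv j (monomial m (1 : ℝ))) = 0) : u = 0 := by
  classical
  have : CharZero L := charZero_of_injective_algebraMap (algebraMap ℝ L).injective
  obtain ⟨k, hk⟩ := Function.ne_iff.mp hz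
  have hk : z k ≠ 0 := hk
  -- test against the monomial `x_k ^ (d - 1) * x_i`, at a coordinate `k` with `z k ≠ 0`
  have key : ∀ i, z k ^ (d - 1) * u i + (d - 1 : ℕ) * z k ^ (d - 2) * z i * u k = 0 := by
    intro i
    have h1 := h (Finsupp.single k (d - 1) + Finsupp.single i 1) (by
      rw [map_add, Finsupp.degree_single, Finsupp.degree_single]; omega)
    have hm : monomial (Finsupp.single k (d - 1) + Finsupp.single i 1) (1 : ℝ) =
        X k ^ (d - 1) * X i := by
      rw [X_pow_eq_monomial, X, monomial_mul, one_mul]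
    rw [hm] at h1
    simp only [Derivation.leibniz, Derivation.leibniz_pow, pderiv_X, smul_eq_mul, map_add, map_mul,
      map_pow, aeval_X, nsmul_eq_mul, map_natCast, mul_add, Finset.sum_add_distrib] at h1
    rw [Finset.sum_eq_single i (fun j _ hj => by simp [hj.symm]) (by simp),
      Finset.sum_eq_single k (fun j _ hj => by simp [hj.symm]) (by simp)] at h1
    simp only [Pi.single_eq_same, map_one] at h1
    rw [← h1, Nat.sub_sub]
    ring
  have hu : u k = 0 := by
    have h1 := key k
    have h2 : (d : L) * z k ^ (d - 1) * u k = 0 := by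
      rw [← h1]
      rcases Nat.lt_or_ge 1 d with hd1 | hd1
      · obtain ⟨e, rfl⟩ := Nat.exists_eq_add_of_le hd1
        rw [show Nat.succ 1 + e - 1 = e + 1 by omega, show Nat.succ 1 + e - 2 = e by omega]
        push_cast
        ring
      · obtain rfl : d = 1 := by omega
        simp
    have hd' : (d : L) ≠ 0 := Nat.cast_ne_zero.mpr hd.ne'
    simpa [hd', hk] using h2
  ext i
  simpa [hu, hk] using key i

/-- Differentiating the criticality equation along the coefficients of the generic form shows
that the degeneracy equation fails in a formally smooth extension of the coefficient ring. -/
theorem not_forall_degeneracyEquations_genericForm {n d : ℕ} (hd : 0 < d) {L : Type*} [Field L]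
    [Algebra (CoeffRing n d) L] [Algebra.FormallySmooth (CoeffRing n d) L] (z : Fin n → L) :
    ¬ ∀ p ∈ degeneracyEquations d (genericForm n d), aeval z p = 0 := by
  classical
  intro hz
  let : Algebra ℝ L := ((algebraMap (CoeffRing n d) L).comp (algebraMap ℝ _)).toAlgebra
  have : IsScalarTower ℝ (CoeffRing n d) L := .of_algebraMap_eq' rfl
  let a : {m : Fin n →₀ ℕ // m.degree = d} → L := fun m => algebraMap (CoeffRing n d) L (X m)
  let p : {m : Fin n →₀ ℕ // m.degree = d} → MvPolynomial (Fin n) ℝ := fun m => monomial m.1 1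
  let lam : L := d * aeval z (genericForm n d)
  let H : Fin n → Fin n → L := fun i j => ∑ m, a m * aeval z (pderiv i (pderiv j (p m)))
  have hq : ∑ i, z i ^ 2 = 1 := by
    have := hz (∑ i, X i ^ 2 - 1) (by simp [degeneracyEquations])
    simpa [sub_eq_zero] using this
  have hc : ∀ j, ∑ m, a m * aeval z (pderiv j (p m)) = lam * z j := by
    intro j
    have := hz (pderiv j (genericForm n d) - (d : MvPolynomial (Fin n) _) * genericForm n d * X j)
      (by simp [degeneracyEquations])
    rw [map_sub, sub_eq_zero, pderiv_genericForm, aeval_sum_C_mul_map] at this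
    exact this.trans (by simp [lam])
  let Mz : Matrix (Fin n ⊕ Unit) (Fin n ⊕ Unit) L :=
    (aeval z : MvPolynomial (Fin n) (CoeffRing n d) →ₐ[CoeffRing n d] L).toRingHom.mapMatrix
      (borderedMatrix d (genericForm n d))
  have hdet : Mz.det = 0 := by
    rw [← RingHom.map_det]
    exact hz _ (by simp [degeneracyEquations])
  obtain ⟨w, hw0, hw⟩ := Matrix.exists_mulVec_eq_zero_iff.mpr hdet
  let u : Fin n → L := fun i => w (Sum.inl i)
  let t : L := w (Sum.inr ())
  have hrow : ∀ i, ∑ j, H i j * u j - lam * u i + z i * t = 0 := by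
    intro i
    have h1 := congrFun hw (Sum.inl i)
    simp only [Mz, borderedMatrix, Matrix.mulVec, dotProduct, Fintype.sum_sum_type,
      RingHom.mapMatrix_apply, Matrix.map_apply, Matrix.fromBlocks_apply₁₁,
      Matrix.fromBlocks_apply₁₂, Matrix.sub_apply, Matrix.of_apply, Matrix.smul_apply,
      pderiv_pderiv_genericForm, AlgHom.toRingHom_eq_coe, RingHom.coe_coe, map_sub,
      aeval_sum_C_mul_map, Matrix.one_apply, smul_eq_mul, mul_ite, mul_one, mul_zero,
      sub_mul, Finset.sum_sub_distrib, apply_ite (aeval z), ite_mul, map_zero, zero_mul,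
      Finset.sum_ite_eq, Finset.mem_univ, if_true, Matrix.replicateCol_apply, aeval_X,
      Finset.univ_unique, Finset.sum_singleton, Pi.zero_apply, map_mul, map_natCast] at h1
    exact h1
  have horth : ∑ j, z j * u j = 0 := by
    have h1 := congrFun hw (Sum.inr ())
    simpa [Mz, borderedMatrix, Matrix.mulVec, dotProduct, Fintype.sum_sum_type] using h1
  have hz0 : z ≠ 0 := by
    rintro rfl
    simp at hq
  have hu : u = 0 := by
    refine eq_zero_of_forall_monomial hd hz0 fun m hm => ?_
    obtain ⟨D, hD⟩ := exists_derivation_extension (L := L)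
      (pderiv (R := ℝ) (⟨m, hm⟩ : {m : Fin n →₀ ℕ // m.degree = d}))
    have hDa : ∀ m', D (a m') = if m' = ⟨m, hm⟩ then 1 else 0 := by
      intro m'
      rw [hD, pderiv_X, Pi.single_apply]
      split_ifs <;> simp
    have hDz : ∑ i, z i * D (z i) = 0 := by
      have := charZero_of_injective_algebraMap (algebraMap ℝ L).injective
      have h1 := congrArg D hq
      simp only [map_sum, Derivation.leibniz_pow, D.map_one_eq_zero] at h1
      have h2 : (2 : L) * ∑ i, z i * D (z i) = 0 := by
        rw [← h1, Finset.mul_sum]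
        refine Finset.sum_congr rfl fun i _ => ?_
        simp
      simpa using h2
    -- the derivative of the criticality equation along the coefficient of `xᵐ`
    have hDc : ∀ j, aeval z (pderiv j (p ⟨m, hm⟩)) + ∑ i, H i j * D (z i) =
        D lam * z j + lam * D (z j) := by
      intro j
      have h1 := congrArg D (hc j)
      simp only [map_sum, Derivation.leibniz, smul_eq_mul, hDa, derivation_aeval,
        Finset.sum_add_distrib, mul_ite, mul_one, mul_zero, Finset.sum_ite_eq', Finset.mem_univ,
        if_true, Finset.mul_sum] at h1
      rw [Finset.sum_comm] at h1
      simp only [H, Finset.sum_mul, ← mul_assoc] at h1 ⊢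
      rw [add_comm, h1]
      ring
    -- pairing with the kernel vector cancels the unknown derivatives of `z` and `lam`
    calc ∑ j, u j * aeval z (pderiv j (p ⟨m, hm⟩))
        = ∑ j, u j * (D lam * z j + lam * D (z j) - ∑ i, H i j * D (z i)) := by
          refine Finset.sum_congr rfl fun j _ => ?_
          rw [← hDc j]; ring
      _ = D lam * ∑ j, z j * u j - ∑ i, (∑ j, H i j * u j - lam * u i) * D (z i) := by
          simp only [mul_sub, mul_add, Finset.sum_sub_distrib, Finset.sum_add_distrib, sub_mul,
            Finset.mul_sum, Finset.sum_mul]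
          rw [Finset.sum_comm (f := fun j i => u j * (H i j * D (z i)))]
          rw [sub_sub_eq_add_sub]
          congr 1
          · congr 1 <;> exact Finset.sum_congr rfl fun j _ => by ring
          · exact Finset.sum_congr rfl fun i _ => Finset.sum_congr rfl fun j _ => by ring
      _ = D lam * ∑ j, z j * u j + t * ∑ i, z i * D (z i) := by
          rw [sub_eq_add_neg, ← Finset.sum_neg_distrib, Finset.mul_sum (a := t)]
          congr 1
          refine Finset.sum_congr rfl fun i _ => ?_
          linear_combination (-D (z i)) * hrow i
      _ = 0 := by rw [horth, hDz]; ring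
  have ht : t = 0 := by
    obtain ⟨k, hk⟩ := Function.ne_iff.mp hz0
    have hk : z k ≠ 0 := hk
    simpa [hu, hk] using hrow k
  apply hw0
  ext (i | i)
  · exact congrFun hu i
  · exact ht

theorem eq_zero_of_mem_degeneracyEquations {n d : ℕ} (f : MvPolynomial (Fin n) ℝ)
    {z : Fin n → ℂ} (h1 : ∑ i, z i ^ 2 = 1)
    (h2 : ∀ i, aeval z (pderiv i f) = (d : ℂ) * aeval z f * z i)
    (h3 : aeval z (borderedDet d f) = 0) :
    ∀ p ∈ degeneracyEquations d f, aeval z p = 0 := by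
  rintro p ((rfl | ⟨i, rfl⟩) | rfl)
  · simp [h1]
  · simp [h2]
  · exact h3

/-- Genericity holds off the zero set of a nonzero polynomial in the coefficients. -/
theorem exists_genericity_polynomial (n : ℕ) {d : ℕ} (hd : 0 < d) :
    ∃ Q : MvPolynomial {m : Fin n →₀ ℕ // m.degree = d} ℝ, Q ≠ 0 ∧
      ∀ f : MvPolynomial (Fin n) ℝ, f.IsHomogeneous d → eval (coeffVec d f) Q ≠ 0 →
        IsGeneric d f := by
  let I := Ideal.span (degeneracyEquations d (genericForm n d))
  have hI : I.comap C ≠ ⊥ := by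
    intro h
    obtain ⟨L, _, _, _, z, hz⟩ := exists_point_of_comap_span_eq_bot _ h
    exact not_forall_degeneracyEquations_genericForm hd z hz
  obtain ⟨Q, hQI, hQ⟩ := Submodule.exists_mem_ne_zero_of_ne_bot hI
  refine ⟨Q, hQ, fun f hf hQf => ?_⟩
  rintro ⟨z, h1, h2, h3⟩
  apply hQf
  let ψ : MvPolynomial (Fin n) (CoeffRing n d) →+* ℂ :=
    (aeval z : MvPolynomial (Fin n) ℝ →ₐ[ℝ] ℂ).toRingHom.comp (map (eval (coeffVec d f)))
  have hle : I ≤ RingHom.ker ψ := by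
    refine Ideal.span_le.mpr fun p hp => ?_
    have hp' : map (eval (coeffVec d f)) p ∈ degeneracyEquations d f := by
      have h := Set.mem_image_of_mem (map (eval (coeffVec d f))) hp
      rwa [image_map_degeneracyEquations, map_genericForm f hf] at h
    exact eq_zero_of_mem_degeneracyEquations f h1 h2 h3 _ hp'
  have hψ : ψ (C Q) = 0 := hle hQI
  simpa [ψ] using hψ

end
end SphereForm

/-! ### Second order conditions on the unit sphere -/

namespace SphereForm

open MvPolynomial

open Topology in
/-- If a quadratic polynomial without constant term is nonnegative near `0` up to a cubic error, its
linear coefficient vanishes and its quadratic coefficient is nonnegative. -/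
theorem jet_of_eventually_nonneg {α β K : ℝ}
    (h : ∀ᶠ t in 𝓝 (0 : ℝ), 0 ≤ α * t + β * t ^ 2 + K * |t| ^ 3) : α = 0 ∧ 0 ≤ β := by
  have hpos : ∀ᶠ t in 𝓝[>] (0 : ℝ), 0 ≤ α * t + β * t ^ 2 + K * |t| ^ 3 :=
    h.filter_mono nhdsWithin_le_nhds
  have hneg : ∀ᶠ t in 𝓝[>] (0 : ℝ), 0 ≤ -α * t + β * t ^ 2 + K * |t| ^ 3 := by
    have h1 : Filter.Tendsto (fun t : ℝ => -t) (𝓝 0) (𝓝 0) := by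
      simpa using (continuous_neg (G := ℝ)).tendsto 0
    refine ((h1.eventually h).filter_mono nhdsWithin_le_nhds).mono fun t ht => ?_
    simpa using ht
  have lim : ∀ a b : ℝ, Filter.Tendsto (fun t : ℝ => a + b * t + K * t ^ 2) (𝓝[>] 0) (𝓝 a) := by
    intro a b
    have : Continuous fun t : ℝ => a + b * t + K * t ^ 2 := by fun_prop
    simpa using (this.tendsto 0).mono_left nhdsWithin_le_nhds
  have aux : ∀ a : ℝ, (∀ᶠ t in 𝓝[>] (0 : ℝ), 0 ≤ a * t + β * t ^ 2 + K * |t| ^ 3) → 0 ≤ a := by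
    intro a ha
    refine ge_of_tendsto (lim a β) ?_
    filter_upwards [ha, self_mem_nhdsWithin] with t ht ht0
    have ht0 : 0 < t := ht0
    rw [abs_of_pos ht0] at ht
    refine le_of_mul_le_mul_right (a := t) ?_ ht0
    nlinarith [ht]
  have hα : α = 0 := le_antisymm (by simpa using aux _ hneg) (aux _ hpos)
  refine ⟨hα, ?_⟩
  have lim' : Filter.Tendsto (fun t : ℝ => β + K * t) (𝓝[>] 0) (𝓝 β) := by
    have : Continuous fun t : ℝ => β + K * t := by fun_prop
    simpa using (this.tendsto 0).mono_left nhdsWithin_le_nhds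
  refine ge_of_tendsto lim' ?_
  filter_upwards [hpos, self_mem_nhdsWithin] with t ht ht0
  have ht0 : 0 < t := ht0
  rw [abs_of_pos ht0, hα] at ht
  refine le_of_mul_le_mul_right (a := t ^ 2) ?_ (pow_pos ht0 2)
  nlinarith [ht]

/-- The terms of order at least three are absorbed in a cubic remainder. -/
theorem two_jet_bound {a b c e q C t : ℝ} (hC : 0 ≤ C) (ht : |t| ≤ 1)
    (h : 0 ≤ (1 + t ^ 2) * (2 * t * a - 2 * t ^ 2 * c) +
      (4 * t ^ 2 * q - 8 * t ^ 3 * b + 4 * t ^ 4 * e) / 2 + 8 * C * |t| ^ 3 * (1 + t ^ 2) ^ 2) :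
    0 ≤ 2 * a * t + 2 * (q - c) * t ^ 2 +
      (2 * |a| + 2 * |c| + 4 * |b| + 2 * |e| + 32 * C) * |t| ^ 3 := by
  have ht4 : 0 ≤ t ^ 4 := by positivity
  have b0 : |t| ^ 3 * |t| ≤ |t| ^ 3 := mul_le_of_le_one_right (by positivity) (by linarith)
  have b1 : t ^ 3 * a ≤ |t| ^ 3 * |a| := by
    rw [← abs_pow, ← abs_mul]; exact le_abs_self _
  have b2 : -(t ^ 3 * b) ≤ |t| ^ 3 * |b| := by
    rw [← abs_pow, ← abs_mul]; exact neg_le_abs _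
  have e4 : t ^ 4 = |t| ^ 3 * |t| := by
    rw [← pow_succ, ← abs_pow, abs_of_nonneg ht4]
  have b3 : -(t ^ 4 * c) ≤ |t| ^ 3 * |c| := by
    calc -(t ^ 4 * c) ≤ |t ^ 4 * c| := neg_le_abs _
      _ = t ^ 4 * |c| := by rw [abs_mul, abs_of_nonneg ht4]
      _ ≤ _ := by rw [e4]; gcongr
  have b4 : t ^ 4 * e ≤ |t| ^ 3 * |e| := by
    calc t ^ 4 * e ≤ |t ^ 4 * e| := le_abs_self _
      _ = t ^ 4 * |e| := by rw [abs_mul, abs_of_nonneg ht4]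
      _ ≤ _ := by rw [e4]; gcongr
  have b5 : C * |t| ^ 3 * (1 + t ^ 2) ^ 2 ≤ C * |t| ^ 3 * 4 := by
    have : t ^ 2 ≤ 1 := by rw [← sq_abs]; nlinarith [abs_nonneg t]
    gcongr
    nlinarith
  linarith

section InnerProductSpace

variable {V : Type*} [NormedAddCommGroup V] [InnerProductSpace ℝ V]

open scoped RealInnerProductSpace

/-- `F` has at `x` the second order expansion with gradient `g` and Hessian `T`, with a cubic
remainder. -/
def HasTaylorTwo (F : V → ℝ) (g : V) (T : V →ₗ[ℝ] V) (x : V) : Prop :=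
  ∃ C : ℝ, 0 ≤ C ∧ ∀ h : V, ‖h‖ ≤ 1 → |F (x + h) - F x - ⟪g, h⟫ - ⟪h, T h⟫ / 2| ≤ C * ‖h‖ ^ 3

/-- The necessary conditions in a unit tangent direction `v`, read off from the great circle through
`x` in that direction. -/
theorem HasTaylorTwo.two_jet_of_isLocalMinOn {F : V → ℝ} {g x : V} {T : V →ₗ[ℝ] V}
    (hF : HasTaylorTwo F g T x) (hT : T.IsSymmetric) (hx : ‖x‖ = 1)
    (hmin : IsLocalMinOn F (Metric.sphere 0 1) x) {v : V} (hv : ‖v‖ = 1) (hxv : ⟪x, v⟫ = 0) :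
    ⟪g, v⟫ = 0 ∧ ⟪g, x⟫ ≤ ⟪v, T v⟫ := by
  obtain ⟨C, hC, hR⟩ := hF
  have hmin' := eventually_nhdsWithin_iff.mp hmin
  obtain ⟨δ, hδ, hball⟩ := Metric.eventually_nhds_iff.mp hmin'
  have hxx : ⟪x, x⟫ = 1 := by rw [real_inner_self_eq_norm_sq, hx]; norm_num
  have hvv : ⟪v, v⟫ = 1 := by rw [real_inner_self_eq_norm_sq, hv]; norm_num
  have hvx : ⟪v, x⟫ = 0 := by rw [real_inner_comm, hxv]
  have hTc : ⟪x, T v⟫ = ⟪v, T x⟫ := by rw [← hT, real_inner_comm]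
  suffices h : 2 * ⟪g, v⟫ = 0 ∧ 0 ≤ 2 * (⟪v, T v⟫ - ⟪g, x⟫) by
    constructor <;> linarith [h.1, h.2]
  refine jet_of_eventually_nonneg
    (K := 2 * |⟪g, v⟫| + 2 * |⟪g, x⟫| + 4 * |⟪v, T x⟫| + 2 * |⟪x, T x⟫| + 32 * C) ?_
  rw [Metric.eventually_nhds_iff]
  refine ⟨min (δ / 2) (1 / 2), by positivity, fun t ht => ?_⟩
  rw [Real.dist_eq, sub_zero, lt_min_iff] at ht
  obtain ⟨ht1, ht2⟩ := ht
  -- `x + h` is the rational parametrization of the great circle through `x` in the direction `v`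
  have hs : 0 < 1 + t ^ 2 := by positivity
  set h : V := (1 + t ^ 2)⁻¹ • ((2 * t) • v - (2 * t ^ 2) • x) with hh
  have hnorm : ‖h‖ ^ 2 = 4 * t ^ 2 / (1 + t ^ 2) := by
    rw [← real_inner_self_eq_norm_sq, hh]
    simp only [inner_smul_left, inner_smul_right, inner_sub_left, inner_sub_right, hxx, hvv, hvx,
      hxv, RCLike.conj_to_real]
    field_simp
    ring
  have hle : ‖h‖ ≤ 2 * |t| := by
    refine abs_le_of_sq_le_sq' ?_ (by positivity) |>.2
    rw [hnorm, mul_pow, sq_abs, div_le_iff₀ hs]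
    nlinarith [sq_nonneg t, sq_nonneg (t ^ 2)]
  have hy : x + h ∈ Metric.sphere (0 : V) 1 := by
    have hxh : ⟪x, h⟫ = - (2 * t ^ 2 / (1 + t ^ 2)) := by
      rw [hh]
      simp only [inner_smul_right, inner_sub_right, hxx, hxv]
      field_simp
      ring
    have : ‖x + h‖ ^ 2 = 1 := by
      rw [norm_add_sq_real, hx, hxh, hnorm]
      field_simp
      ring
    rw [mem_sphere_zero_iff_norm]
    exact (pow_eq_one_iff_of_nonneg (norm_nonneg _) two_ne_zero).mp this
  have hF := hball (y := x + h) (by rw [dist_eq_norm, add_sub_cancel_left]; linarith) hy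
  have hR' := (abs_le.mp (hR h (by linarith))).2
  have hcube : ‖h‖ ^ 3 ≤ 8 * |t| ^ 3 := by
    calc ‖h‖ ^ 3 ≤ (2 * |t|) ^ 3 := by gcongr
      _ = 8 * |t| ^ 3 := by ring
  have hmain : 0 ≤ ⟪g, h⟫ + ⟪h, T h⟫ / 2 + 8 * C * |t| ^ 3 := by nlinarith
  have hgh : ⟪g, h⟫ = (1 + t ^ 2)⁻¹ * (2 * t * ⟪g, v⟫ - 2 * t ^ 2 * ⟪g, x⟫) := by
    rw [hh]; simp only [inner_smul_right, inner_sub_right]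
  have hhT : ⟪h, T h⟫ = ((1 + t ^ 2)⁻¹) ^ 2 *
      (4 * t ^ 2 * ⟪v, T v⟫ - 8 * t ^ 3 * ⟪v, T x⟫ + 4 * t ^ 4 * ⟪x, T x⟫) := by
    rw [hh]
    simp only [map_smul, map_sub, inner_smul_left, inner_smul_right, inner_sub_left,
      inner_sub_right, RCLike.conj_to_real, hTc]
    ring
  rw [hgh, hhT] at hmain
  have hmain2 : 0 ≤ (1 + t ^ 2) * (2 * t * ⟪g, v⟫ - 2 * t ^ 2 * ⟪g, x⟫) +
      (4 * t ^ 2 * ⟪v, T v⟫ - 8 * t ^ 3 * ⟪v, T x⟫ + 4 * t ^ 4 * ⟪x, T x⟫) / 2 +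
      8 * C * |t| ^ 3 * (1 + t ^ 2) ^ 2 := by
    have := mul_nonneg hmain (sq_nonneg (1 + t ^ 2))
    field_simp at this
    linarith
  exact two_jet_bound hC (by linarith) hmain2

/-- The first and second order necessary conditions for a minimum on the unit sphere. -/
theorem HasTaylorTwo.necessary {F : V → ℝ} {g x : V} {T : V →ₗ[ℝ] V}
    (hF : HasTaylorTwo F g T x) (hT : T.IsSymmetric) (hx : ‖x‖ = 1)
    (hmin : IsLocalMinOn F (Metric.sphere 0 1) x) :
    g = ⟪g, x⟫ • x ∧ ∀ v, ⟪x, v⟫ = 0 → ⟪g, x⟫ * ‖v‖ ^ 2 ≤ ⟪v, T v⟫ := by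
  have key : ∀ v, ⟪x, v⟫ = 0 → ⟪g, v⟫ = 0 ∧ ⟪g, x⟫ * ‖v‖ ^ 2 ≤ ⟪v, T v⟫ := by
    intro v hv
    rcases eq_or_ne v 0 with rfl | hv0
    · simp
    have hn : ‖v‖ ≠ 0 := norm_ne_zero_iff.mpr hv0
    obtain ⟨h1, h2⟩ := hF.two_jet_of_isLocalMinOn hT hx hmin (v := ‖v‖⁻¹ • v)
      (by rw [norm_smul, norm_inv, norm_norm, inv_mul_cancel₀ hn])
      (by rw [inner_smul_right, hv, mul_zero])
    constructor
    · simpa [inner_smul_right, hn] using h1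
    · simp only [map_smul, inner_smul_left, inner_smul_right, RCLike.conj_to_real] at h2
      field_simp at h2
      linarith
  refine ⟨?_, fun v hv => (key v hv).2⟩
  have hxx : ⟪x, x⟫ = 1 := by rw [real_inner_self_eq_norm_sq, hx]; norm_num
  have hw : ⟪x, g - ⟪g, x⟫ • x⟫ = 0 := by
    rw [inner_sub_right, inner_smul_right, hxx, real_inner_comm]; ring
  rw [← sub_eq_zero, ← inner_self_eq_zero (𝕜 := ℝ)]
  rw [inner_sub_left, inner_smul_left, hw, (key _ hw).1]
  simp

/-- The second order sufficient condition for a minimum on the unit sphere. -/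
theorem HasTaylorTwo.sufficient [FiniteDimensional ℝ V] {F : V → ℝ} {x : V} {T : V →ₗ[ℝ] V}
    {c μ : ℝ} (hF : HasTaylorTwo F (c • x) T x) (hT : T.IsSymmetric) (hx : ‖x‖ = 1)
    (hμ : T x = μ • x) (hpos : ∀ v, v ≠ 0 → ⟪x, v⟫ = 0 → c * ‖v‖ ^ 2 < ⟪v, T v⟫) :
    IsLocalMinOn F (Metric.sphere 0 1) x := by
  obtain ⟨C, hC, hR⟩ := hF
  have hxx : ⟪x, x⟫ = 1 := by rw [real_inner_self_eq_norm_sq, hx]; norm_num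
  have hTcont : Continuous T := T.continuous_of_finiteDimensional
  -- a uniform gap, by compactness of the unit sphere of the tangent space
  obtain ⟨m, hm, hgap⟩ : ∃ m, 0 < m ∧ ∀ v, ⟪x, v⟫ = 0 → m * ‖v‖ ^ 2 + c * ‖v‖ ^ 2 ≤ ⟪v, T v⟫ := by
    have hK : IsCompact (Metric.sphere (0 : V) 1 ∩ {v | ⟪x, v⟫ = 0}) :=
      (isCompact_sphere 0 1).inter_right (isClosed_eq (by fun_prop) continuous_const)
    obtain ⟨c', hc', hle⟩ := hK.exists_forall_le' (f := fun v => ⟪v, T v⟫) (a := c)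
      (by fun_prop) (by
        rintro v ⟨hv1, hv2⟩
        have hn : ‖v‖ = 1 := by simpa using hv1
        have := hpos v (by rintro rfl; simp at hn) hv2
        simpa [hn] using this)
    refine ⟨c' - c, sub_pos.mpr hc', fun v hv => ?_⟩
    rcases eq_or_ne v 0 with rfl | hv0
    · simp
    have hn : ‖v‖ ≠ 0 := norm_ne_zero_iff.mpr hv0
    have h2 := hle (‖v‖⁻¹ • v) ⟨by
      rw [mem_sphere_zero_iff_norm, norm_smul, norm_inv, norm_norm, inv_mul_cancel₀ hn], by
      simp only [Set.mem_ofPred_eq, inner_smul_right, hv, mul_zero]⟩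
    simp only [map_smul, inner_smul_left, inner_smul_right, RCLike.conj_to_real] at h2
    field_simp at h2
    linarith
  set B := m + |μ - c| + 2 * C with hB
  have hBpos : 0 < B := by positivity
  refine eventually_nhdsWithin_iff.mpr (Metric.eventually_nhds_iff.mpr
    ⟨m / B, by positivity, fun y hy hys => ?_⟩)
  rw [dist_eq_norm] at hy
  set h := y - x with hh
  have hr1 : ‖h‖ * B < m := (lt_div_iff₀ hBpos).mp hy
  have hrm : m ≤ B := by rw [hB]; linarith [abs_nonneg (μ - c)]
  have hr : ‖h‖ ≤ 1 := by
    by_contra hcon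
    nlinarith
  have hyx : y = x + h := by rw [hh]; abel
  have hyn : ‖y‖ = 1 := by simpa using hys
  have hxh : ⟪x, h⟫ = -(‖h‖ ^ 2 / 2) := by
    have := norm_add_sq_real x h
    rw [← hyx, hyn, hx] at this
    linarith
  set s := ‖h‖ ^ 2 / 2 with hs
  -- the tangential part of the displacement
  set w := h + s • x with hw
  have hxw : ⟪x, w⟫ = 0 := by rw [hw, inner_add_right, inner_smul_right, hxx, hxh]; ring
  have hhw : h = w - s • x := by rw [hw]; abel
  have hwn : ‖w‖ ^ 2 = ‖h‖ ^ 2 - s ^ 2 := by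
    rw [hw, norm_add_sq_real, inner_smul_right, real_inner_comm, hxh, norm_smul, hx,
      Real.norm_eq_abs, mul_one, sq_abs]
    ring
  have hTw : ⟪h, T h⟫ = ⟪w, T w⟫ + s ^ 2 * μ := by
    have h1 : ⟪x, T w⟫ = 0 := by
      rw [← hT, hμ, inner_smul_left, hxw, mul_zero]
    rw [hhw]
    simp only [map_sub, map_smul, hμ, inner_sub_left, inner_sub_right, inner_smul_left,
      inner_smul_right, RCLike.conj_to_real, h1, hxx, real_inner_comm x w, hxw]
    ring
  have hR' := (abs_le.mp (hR h hr)).1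
  rw [← hyx, inner_smul_left, hxh, RCLike.conj_to_real, hTw] at hR'
  have hg := hgap w hxw
  rw [hwn] at hg
  have habs : -(|μ - c|) ≤ μ - c := neg_abs_le _
  have hs2 : s ^ 2 ≤ ‖h‖ ^ 3 := by
    have h0 := norm_nonneg h
    have : ‖h‖ ^ 4 ≤ ‖h‖ ^ 3 := pow_le_pow_of_le_one h0 hr (by norm_num)
    rw [hs]
    nlinarith [pow_nonneg h0 3]
  have h3 : ‖h‖ ^ 3 * B ≤ ‖h‖ ^ 2 * m := by
    nlinarith [sq_nonneg ‖h‖]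
  have h4 : s ^ 2 * (m + |μ - c|) ≤ ‖h‖ ^ 3 * (m + |μ - c|) := by gcongr
  have h5 : s ^ 2 * -(|μ - c|) ≤ s ^ 2 * (μ - c) := by gcongr
  have h6 : ‖h‖ ^ 2 = 2 * s := by rw [hs]; ring
  rw [hB] at h3
  rw [h6] at hg h3
  change F x ≤ F y
  linarith

end InnerProductSpace

end SphereForm

/-! ### Taylor expansion, Euler identities and nondegeneracy -/

namespace SphereForm

open MvPolynomial
noncomputable section
open scoped RealInnerProductSpace

/-- The Hessian of `f` at `x` as a linear map. -/
def hessLin {n : ℕ} (f : MvPolynomial (Fin n) ℝ) (x : E n) : E n →ₗ[ℝ] E n :=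
  Matrix.toEuclideanLin (hess f x)

theorem hessLin_isSymmetric {n : ℕ} (f : MvPolynomial (Fin n) ℝ) (x : E n) :
    (hessLin f x).IsSymmetric :=
  Matrix.isSymmetric_toEuclideanLin_iff.mpr (hess_isHermitian f x)

theorem hessLin_apply {n : ℕ} (f : MvPolynomial (Fin n) ℝ) (x v : E n) (i : Fin n) :
    hessLin f x v i = ∑ j, value (pderiv i (pderiv j f)) x * v j := rfl

theorem inner_grad {n : ℕ} (f : MvPolynomial (Fin n) ℝ) (x h : E n) :
    ⟪grad f x, h⟫ = ∑ i, value (pderiv i f) x * h i := by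
  simp [PiLp.inner_apply, grad, mul_comm]

theorem inner_hessLin {n : ℕ} (f : MvPolynomial (Fin n) ℝ) (x h : E n) :
    ⟪h, hessLin f x h⟫ = ∑ i, ∑ j, value (pderiv i (pderiv j f)) x * h i * h j := by
  simp only [PiLp.inner_apply, hessLin_apply, RCLike.inner_apply, conj_trivial, Finset.sum_mul]
  exact Finset.sum_congr rfl fun i _ => Finset.sum_congr rfl fun j _ => by ring

theorem inner_grad_mul_X {n : ℕ} (f : MvPolynomial (Fin n) ℝ) (k : Fin n) (x h : E n) :
    ⟪grad (f * X k) x, h⟫ = ⟪grad f x, h⟫ * x k + value f x * h k := by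
  simp only [inner_grad, Derivation.leibniz, pderiv_X, smul_eq_mul, value, map_add, map_mul, eval_X,
    add_mul, Finset.sum_add_distrib]
  rw [Finset.sum_eq_single k (fun j _ hj => by simp [hj.symm]) (by simp), Finset.sum_mul, add_comm]
  congr 1
  · exact Finset.sum_congr rfl fun j _ => by ring
  · simp

theorem inner_hessLin_mul_X {n : ℕ} (f : MvPolynomial (Fin n) ℝ) (k : Fin n) (x h : E n) :
    ⟪h, hessLin (f * X k) x h⟫ = ⟪h, hessLin f x h⟫ * x k + 2 * ⟪grad f x, h⟫ * h k := by
  have h0 : ∀ i j : Fin n, pderiv i (if k = j then (1 : MvPolynomial (Fin n) ℝ) else 0) = 0 := by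
    intro i j
    split_ifs <;> simp
  have h1 : ∀ i j : Fin n, value (pderiv i (pderiv j (f * X k))) x =
      value (pderiv i (pderiv j f)) x * x k + value (pderiv j f) x * (if k = i then 1 else 0) +
        value (pderiv i f) x * (if k = j then 1 else 0) := by
    intro i j
    simp only [Derivation.leibniz, pderiv_X, smul_eq_mul, value, map_add, map_mul, eval_X,
      Pi.single_apply, h0, apply_ite (eval fun i => x i), map_one, map_zero]
    ring
  simp only [inner_hessLin, inner_grad, h1, add_mul, Finset.sum_add_distrib]
  have h2 : ∑ i, ∑ j, value (pderiv j f) x * (if k = i then 1 else 0) * h i * h j =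
      (∑ i, value (pderiv i f) x * h i) * h k := by
    rw [Finset.sum_eq_single k (fun j _ hj => by simp [hj.symm]) (by simp), Finset.sum_mul]
    exact Finset.sum_congr rfl fun j _ => by simp; ring
  have h3 : ∑ i, ∑ j, value (pderiv i f) x * (if k = j then 1 else 0) * h i * h j =
      (∑ i, value (pderiv i f) x * h i) * h k := by
    rw [Finset.sum_mul]
    exact Finset.sum_congr rfl fun i _ => by simp
  have h4 : ∑ i, ∑ j, value (pderiv i (pderiv j f)) x * x k * h i * h j =
      (∑ i, ∑ j, value (pderiv i (pderiv j f)) x * h i * h j) * x k := by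
    simp only [Finset.sum_mul]
    exact Finset.sum_congr rfl fun i _ => Finset.sum_congr rfl fun j _ => by ring
  rw [h2, h3, h4]
  ring

/-- Polynomials have second order Taylor expansions with cubic remainder. -/
theorem hasTaylorTwo_value {n : ℕ} (f : MvPolynomial (Fin n) ℝ) (x : E n) :
    HasTaylorTwo (value f) (grad f x) (hessLin f x) x := by
  induction f using MvPolynomial.induction_on with
  | C a => exact ⟨0, le_rfl, fun h _ => by simp [inner_grad, inner_hessLin, value]⟩
  | add p q hp hq =>
    obtain ⟨C, hC, hR⟩ := hp
    obtain ⟨C', hC', hR'⟩ := hq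
    refine ⟨C + C', by positivity, fun h hh => ?_⟩
    have e1 : ⟪grad (p + q) x, h⟫ = ⟪grad p x, h⟫ + ⟪grad q x, h⟫ := by
      simp [inner_grad, value, add_mul, Finset.sum_add_distrib]
    have e2 : ⟪h, hessLin (p + q) x h⟫ = ⟪h, hessLin p x h⟫ + ⟪h, hessLin q x h⟫ := by
      simp [inner_hessLin, value, add_mul, Finset.sum_add_distrib]
    have e3 : ∀ y, value (p + q) y = value p y + value q y := fun y => by simp [value]
    have := abs_add_le (value p (x + h) - value p x - ⟪grad p x, h⟫ - ⟪h, hessLin p x h⟫ / 2)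
      (value q (x + h) - value q x - ⟪grad q x, h⟫ - ⟪h, hessLin q x h⟫ / 2)
    rw [e1, e2, e3, e3, add_mul]
    refine le_trans (le_of_eq ?_) (this.trans (add_le_add (hR h hh) (hR' h hh)))
    congr 1
    ring
  | mul_X p k hp =>
    obtain ⟨C, hC, hR⟩ := hp
    let T := (hessLin p x).toContinuousLinearMap
    refine ⟨C * |x k| + C + ‖T‖ / 2, by positivity, fun h hh => ?_⟩
    have e3 : ∀ y, value (p * X k) y = value p y * y k := fun y => by simp [value]
    rw [inner_grad_mul_X, inner_hessLin_mul_X, e3, e3]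
    have hk : |h k| ≤ ‖h‖ := by simpa using PiLp.norm_apply_le h k
    have hq : |⟪h, hessLin p x h⟫| ≤ ‖T‖ * ‖h‖ ^ 2 := by
      calc |⟪h, T h⟫| ≤ ‖h‖ * ‖T h‖ := abs_real_inner_le_norm _ _
        _ ≤ ‖h‖ * (‖T‖ * ‖h‖) := by gcongr; exact T.le_opNorm h
        _ = _ := by ring
    set R := value p (x + h) - value p x - ⟪grad p x, h⟫ - ⟪h, hessLin p x h⟫ / 2 with hRdef
    have hR1 := hR h hh
    calc |value p (x + h) * (x + h) k - value p x * x k - (⟪grad p x, h⟫ * x k + value p x * h k) -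
          (⟪h, hessLin p x h⟫ * x k + 2 * ⟪grad p x, h⟫ * h k) / 2|
        = |R * x k + (R * h k + ⟪h, hessLin p x h⟫ * h k / 2)| := by
          congr 1
          rw [hRdef, PiLp.add_apply]
          ring
      _ ≤ |R * x k| + (|R * h k| + |⟪h, hessLin p x h⟫ * h k / 2|) :=
          (abs_add_le _ _).trans (add_le_add le_rfl (abs_add_le _ _))
      _ ≤ C * ‖h‖ ^ 3 * |x k| + (C * ‖h‖ ^ 3 * 1 + ‖T‖ * ‖h‖ ^ 2 * ‖h‖ / 2) := by
          rw [abs_mul, abs_mul, abs_div, abs_mul, abs_two]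
          gcongr
          exact hk.trans hh
      _ = _ := by ring

variable {n d : ℕ} {f : MvPolynomial (Fin n) ℝ}

/-- Euler's identity for the gradient. -/
theorem sum_mul_value_pderiv (hf : f.IsHomogeneous d) (x : E n) :
    ∑ i, value (pderiv i f) x * x i = d * value f x := by
  have := congrArg (eval fun i => x i) hf.sum_X_mul_pderiv
  simpa [value, mul_comm] using this

theorem inner_grad_self (hf : f.IsHomogeneous d) (x : E n) : ⟪grad f x, x⟫ = d * value f x := by
  rw [inner_grad, sum_mul_value_pderiv hf]

/-- Euler's identity for the Hessian. -/
theorem hessLin_self (hf : f.IsHomogeneous d) (x : E n) :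
    hessLin f x x = ((d - 1 : ℕ) : ℝ) • grad f x := by
  ext i
  rw [hessLin_apply]
  simp only [pderiv_comm i, sum_mul_value_pderiv (hf.pderiv (i := i))]
  simp [grad]

theorem mem_Theta_iff (hf : f.IsHomogeneous d) {x : E n} (hx : ‖x‖ = 1) :
    x ∈ Theta d f ↔ grad f x = (d * value f x) • x := by
  have hi := inner_grad_self hf x
  have hxx : ⟪x, x⟫ = 1 := by rw [real_inner_self_eq_norm_sq, hx]; norm_num
  constructor
  · rintro ⟨-, h⟩
    have h2 : ‖grad f x‖ ^ 2 = (d * value f x) ^ 2 := by rw [h, mul_pow, sq_abs, mul_pow]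
    rw [← sub_eq_zero, ← norm_eq_zero, ← sq_eq_zero_iff, norm_sub_sq_real, norm_smul, hx,
      inner_smul_right, hi, h2, Real.norm_eq_abs, mul_one, sq_abs]
    ring
  · intro h
    refine ⟨by simpa [unitSphere] using hx, ?_⟩
    rw [h, norm_smul, hx, mul_one, Real.norm_eq_abs, abs_mul, Nat.abs_cast]

/-- At a real critical point on the sphere, genericity makes the tangential Hessian
nondegenerate. -/
theorem eq_zero_of_isGeneric (hgen : IsGeneric d f) {x v : E n} (hx : ‖x‖ = 1)
    (hc : grad f x = (d * value f x) • x) (hxv : ⟪x, v⟫ = 0)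
    (hv : hessLin f x v = (d * value f x) • v) : v = 0 := by
  by_contra hv0
  have hcast : ∀ p : MvPolynomial (Fin n) ℝ, aeval (fun i => (x i : ℂ)) p = (value p x : ℂ) := by
    intro p
    have := aeval_algebraMap_apply (A := ℝ) ℂ (fun i => x i) p
    have e : aeval (fun i => x i) p = value p x := by rw [value, ← coe_aeval_eq_eval]; rfl
    rw [e] at this
    exact this
  apply hgen
  refine ⟨fun i => (x i : ℂ), ?_, fun i => ?_, ?_⟩
  · have h := EuclideanSpace.real_norm_sq_eq x
    rw [hx] at h
    have h' : ∑ i, x i ^ 2 = 1 := by rw [← h]; norm_num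
    change ∑ i, (x i : ℂ) ^ 2 = 1
    exact_mod_cast h'
  · rw [hcast, hcast]
    have h := congrArg (fun y : E n => y i) hc
    have h' : value (pderiv i f) x = d * value f x * x i := by simpa [grad] using h
    rw [h']
    push_cast
    ring
  · rw [hcast, Complex.ofReal_eq_zero]
    change eval (fun i => x i) (borderedMatrix d f).det = 0
    rw [RingHom.map_det, ← Matrix.exists_mulVec_eq_zero_iff]
    refine ⟨Sum.elim (fun i => v i) 0, ?_, ?_⟩
    · intro h
      apply hv0
      ext i
      exact congrFun h (Sum.inl i)
    · ext (i | i)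
      · have h := congrArg (fun y : E n => y i) hv
        have h' : ∑ j, value (pderiv i (pderiv j f)) x * v j = d * value f x * v i := by
          simpa [hessLin_apply] using h
        simp [borderedMatrix, Matrix.mulVec, dotProduct, Fintype.sum_sum_type, Matrix.one_apply,
          sub_mul, apply_ite (eval fun i => x i)]
        rw [sub_eq_zero]
        exact h'
      · have h : ∑ j, x j * v j = 0 := by
          rw [← hxv]; simp [PiLp.inner_apply, mul_comm]
        simpa [borderedMatrix, Matrix.mulVec, dotProduct, Fintype.sum_sum_type] using h

end
end SphereForm

/-! ### Eigenvalues of the Hessian and local minima -/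

namespace SphereForm

open MvPolynomial
open scoped RealInnerProductSpace

section Eigenbasis

variable {V : Type*} [NormedAddCommGroup V] [InnerProductSpace ℝ V] {n : ℕ}

theorem inner_map_self_eq_sum {T : V →ₗ[ℝ] V} (hT : T.IsSymmetric)
    (b : OrthonormalBasis (Fin n) ℝ V) {l : Fin n → ℝ} (hb : ∀ k, T (b k) = l k • b k) (v : V) :
    ⟪v, T v⟫ = ∑ k, l k * ⟪b k, v⟫ ^ 2 := by
  rw [← b.sum_inner_mul_inner v (T v)]
  refine Finset.sum_congr rfl fun k _ => ?_
  rw [← hT, hb, inner_smul_left, RCLike.conj_to_real, real_inner_comm v (b k)]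
  ring

theorem norm_sq_eq_sum (b : OrthonormalBasis (Fin n) ℝ V) (v : V) :
    ‖v‖ ^ 2 = ∑ k, ⟪b k, v⟫ ^ 2 := by
  rw [← real_inner_self_eq_norm_sq, ← b.sum_inner_mul_inner v v]
  refine Finset.sum_congr rfl fun k _ => ?_
  rw [real_inner_comm v (b k)]
  ring

/-- The smallest eigenvalue is at least `c` iff the quadratic form is bounded below by `c`. -/
theorem le_first_eigenvalue_iff {T : V →ₗ[ℝ] V} (hT : T.IsSymmetric)
    (b : OrthonormalBasis (Fin n) ℝ V) {l : Fin n → ℝ} (hl : Monotone l)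
    (hb : ∀ k, T (b k) = l k • b k) (hn : 0 < n) (c : ℝ) :
    c ≤ l ⟨0, hn⟩ ↔ ∀ v, c * ‖v‖ ^ 2 ≤ ⟪v, T v⟫ := by
  constructor
  · intro h v
    rw [inner_map_self_eq_sum hT b hb, norm_sq_eq_sum b, Finset.mul_sum]
    refine Finset.sum_le_sum fun k _ => ?_
    have : c ≤ l k := h.trans (hl (Fin.mk_le_of_le_val (Nat.zero_le _)))
    gcongr
  · intro h
    have h1 := h (b ⟨0, hn⟩)
    rw [hb, inner_smul_right, real_inner_self_eq_norm_sq, b.norm_eq_one] at h1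
    simpa using h1

/-- If `x` is a unit eigenvector with eigenvalue below `c`, then the second smallest eigenvalue is
at least `c` iff the quadratic form is bounded below by `c` on the orthogonal complement of `x`. -/
theorem le_second_eigenvalue_iff {T : V →ₗ[ℝ] V} (hT : T.IsSymmetric)
    (b : OrthonormalBasis (Fin n) ℝ V) {l : Fin n → ℝ} (hl : Monotone l)
    (hb : ∀ k, T (b k) = l k • b k) (hn : 1 < n) {c μ : ℝ} {x : V} (hx : x ≠ 0)
    (hμ : T x = μ • x) (hμc : μ < c) :
    c ≤ l ⟨1, hn⟩ ↔ ∀ v, ⟪x, v⟫ = 0 → c * ‖v‖ ^ 2 ≤ ⟪v, T v⟫ := by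
  let i0 : Fin n := ⟨0, by omega⟩
  let i1 : Fin n := ⟨1, hn⟩
  constructor
  · intro h v hv
    have hle : ∀ k, k ≠ i0 → c ≤ l k := by
      intro k hk
      refine h.trans (hl (Fin.mk_le_of_le_val ?_))
      have : (k : ℕ) ≠ 0 := fun h0 => hk (Fin.ext h0)
      omega
    have horth : ∀ k, k ≠ i0 → ⟪b k, x⟫ = 0 := by
      intro k hk
      have h1 := hT (b k) x
      rw [hb, hμ, inner_smul_left, inner_smul_right, RCLike.conj_to_real] at h1
      have h2 : (l k - μ) * ⟪b k, x⟫ = 0 := by linarith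
      refine (mul_eq_zero.mp h2).resolve_left ?_
      have := hle k hk
      linarith
    have hx0 : ⟪b i0, x⟫ ≠ 0 := by
      intro h0
      apply hx
      rw [← norm_eq_zero, ← sq_eq_zero_iff, norm_sq_eq_sum b]
      refine Finset.sum_eq_zero fun k _ => ?_
      by_cases hk : k = i0
      · rw [hk, h0]; norm_num
      · rw [horth k hk]; norm_num
    have hv0 : ⟪b i0, v⟫ = 0 := by
      rw [← b.sum_inner_mul_inner x v, Finset.sum_eq_single i0
        (fun k _ hk => by rw [real_inner_comm, horth k hk, zero_mul]) (by simp),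
        real_inner_comm] at hv
      exact (mul_eq_zero.mp hv).resolve_left hx0
    rw [inner_map_self_eq_sum hT b hb, norm_sq_eq_sum b, Finset.mul_sum]
    refine Finset.sum_le_sum fun k _ => ?_
    by_cases hk : k = i0
    · rw [hk, hv0]; norm_num
    · have := hle k hk
      gcongr
  · intro h
    by_contra! hlt
    have hl1 : l i1 < c := hlt
    have hl0 : l i0 < c := (hl (Fin.mk_le_of_le_val (Nat.zero_le _))).trans_lt hlt
    have h01 : ⟪b i0, b i1⟫ = 0 := b.orthonormal.2 (by simp [i0, i1])
    have h10 : ⟪b i1, b i0⟫ = 0 := by rw [real_inner_comm, h01]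
    have h00 : ⟪b i0, b i0⟫ = 1 := by rw [real_inner_self_eq_norm_sq, b.norm_eq_one]; norm_num
    have h11 : ⟪b i1, b i1⟫ = 1 := by rw [real_inner_self_eq_norm_sq, b.norm_eq_one]; norm_num
    -- a plane spanned by two eigenvectors meets the orthogonal complement of `x`
    have key : ∀ α β : ℝ, α * ⟪x, b i0⟫ + β * ⟪x, b i1⟫ = 0 →
        c * (α ^ 2 + β ^ 2) ≤ l i0 * α ^ 2 + l i1 * β ^ 2 := by
      intro α β hαβ
      have h1 := h (α • b i0 + β • b i1) (by
        rw [inner_add_right, inner_smul_right, inner_smul_right, hαβ])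
      rw [← real_inner_self_eq_norm_sq] at h1
      simp only [map_add, map_smul, hb, inner_add_left, inner_add_right, inner_smul_left,
        inner_smul_right, RCLike.conj_to_real, h00, h01, h10, h11] at h1
      linarith
    have h1 := key ⟪x, b i1⟫ (-⟪x, b i0⟫) (by ring)
    by_cases hz : ⟪x, b i0⟫ = 0
    · have h2 := key 1 0 (by rw [hz]; ring)
      linarith
    · have : 0 < ⟪x, b i0⟫ ^ 2 := by positivity
      nlinarith [sq_nonneg ⟪x, b i1⟫]

end Eigenbasis

/-- An orthonormal eigenbasis of the Hessian, ordered like `hessEig`. -/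
theorem exists_hess_eigenbasis {n : ℕ} (f : MvPolynomial (Fin n) ℝ) (x : E n) :
    ∃ b : OrthonormalBasis (Fin n) ℝ (E n), ∀ k, hessLin f x (b k) = hessEig f x k • b k := by
  let e : Fin (Fintype.card (Fin n)) ≃ Fin n := Fintype.equivOfCardEq (Fintype.card_fin _)
  let σ : Fin n ≃ Fin n := (Fin.revPerm.trans (finCongr (Fintype.card_fin n).symm)).trans e
  refine ⟨(hess_isHermitian f x).eigenvectorBasis.reindex σ.symm, fun k => ?_⟩
  rw [OrthonormalBasis.reindex_apply, Equiv.symm_symm]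
  have h := (hess_isHermitian f x).mulVec_eigenvectorBasis (σ k)
  have hk : (hess_isHermitian f x).eigenvalues (σ k) = hessEig f x k := by
    simp only [Matrix.IsHermitian.eigenvalues, hessEig, σ, Equiv.trans_apply]
    congr 1
    exact e.symm_apply_apply _
  rw [hk] at h
  ext i
  exact congrFun h i

variable {n d : ℕ} {f : MvPolynomial (Fin n) ℝ}

theorem hessLin_self_of_critical (hf : f.IsHomogeneous d) {x : E n}
    (hc : grad f x = (d * value f x) • x) :
    hessLin f x x = (((d - 1 : ℕ) : ℝ) * (d * value f x)) • x := by
  rw [hessLin_self hf, hc, smul_smul]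

/-- For a generic form, the second order necessary condition for a minimum on the sphere is also
sufficient. -/
theorem isLocalMinOn_iff (hf : f.IsHomogeneous d) (hgen : IsGeneric d f) {x : E n}
    (hx : ‖x‖ = 1) :
    IsLocalMinOn (value f) (unitSphere n) x ↔ grad f x = (d * value f x) • x ∧
      ∀ v, ⟪x, v⟫ = 0 → d * value f x * ‖v‖ ^ 2 ≤ ⟪v, hessLin f x v⟫ := by
  have hT := hasTaylorTwo_value f x
  have hS := hessLin_isSymmetric f x
  constructor
  · intro h
    have := hT.necessary hS hx h
    rwa [inner_grad_self hf] at this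
  · rintro ⟨hc, hpsd⟩
    have hμ := hessLin_self_of_critical hf hc
    have hxx : ⟪x, x⟫ = 1 := by rw [real_inner_self_eq_norm_sq, hx]; norm_num
    refine HasTaylorTwo.sufficient (hc ▸ hT) hS hx hμ fun v hv hxv => ?_
    refine lt_of_le_of_ne (hpsd v hxv) fun heq => hv (eq_zero_of_isGeneric hgen hx hc hxv ?_)
    set c := d * value f x with hcdef
    set T := hessLin f x with hTdef
    -- a null vector of a semidefinite form lies in its radical
    have hw : ∀ w, ⟪x, w⟫ = 0 → ⟪w, T v - c • v⟫ = 0 := by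
      intro w hxw
      have hq : ∀ t : ℝ, 0 ≤ 2 * ⟪w, T v - c • v⟫ * t + (⟪w, T w⟫ - c * ‖w‖ ^ 2) * t ^ 2 := by
        intro t
        have h1 := hpsd (v + t • w) (by rw [inner_add_right, inner_smul_right, hxv, hxw]; ring)
        have hvw : ⟪v, T w⟫ = ⟪w, T v⟫ := by rw [← hS, real_inner_comm]
        rw [norm_add_sq_real, norm_smul, mul_pow, Real.norm_eq_abs, sq_abs] at h1
        simp only [map_add, map_smul, inner_add_left, inner_add_right, inner_smul_left,
          inner_smul_right, RCLike.conj_to_real, hvw, ← heq] at h1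
        rw [inner_sub_right, inner_smul_right, real_inner_comm v w]
        linarith
      have h2 := (jet_of_eventually_nonneg (K := 0)
        (Filter.Eventually.of_forall fun t => by simpa using hq t)).1
      linarith
    have hx' : ⟪x, T v - c • v⟫ = 0 := by
      rw [inner_sub_right, inner_smul_right, hxv, ← hS, hμ, inner_smul_left, hxv]
      ring
    have h0 := hw _ hx'
    rwa [inner_self_eq_zero, sub_eq_zero] at h0

/-- At points with nonnegative value, the condition on the first eigenvalue characterizes local
minima. -/
theorem isLocalMinOn_iff_of_nonneg (hf : f.IsHomogeneous d) (hgen : IsGeneric d f) (hd : 2 ≤ d)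
    (hn : 0 < n) {x : E n} (h0 : 0 ≤ value f x) :
    (x ∈ unitSphere n ∧ IsLocalMinOn (value f) (unitSphere n) x) ↔
      x ∈ Theta d f ∧ ‖grad f x‖ ≤ hessEig f x ⟨0, hn⟩ := by
  by_cases hxs : x ∈ unitSphere n
  swap
  · exact ⟨fun h => absurd h.1 hxs, fun h => absurd h.1.1 hxs⟩
  have hx : ‖x‖ = 1 := by simpa [unitSphere] using hxs
  have hxx : ⟪x, x⟫ = 1 := by rw [real_inner_self_eq_norm_sq, hx]; norm_num
  obtain ⟨b, hb⟩ := exists_hess_eigenbasis f x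
  have hS := hessLin_isSymmetric f x
  rw [isLocalMinOn_iff hf hgen hx, mem_Theta_iff hf hx]
  simp only [hxs, true_and]
  refine and_congr_right fun hc => ?_
  have hcn : 0 ≤ d * value f x := by positivity
  have hnorm : ‖grad f x‖ = d * value f x := by
    rw [hc, norm_smul, hx, mul_one, Real.norm_eq_abs, abs_of_nonneg hcn]
  rw [hnorm, le_first_eigenvalue_iff hS b (hessEig_monotone f x) hb hn]
  refine ⟨fun h v => ?_, fun h v _ => h v⟩
  have hμ := hessLin_self_of_critical hf hc
  set c := d * value f x with hcdef
  set w := v - ⟪x, v⟫ • x with hw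
  have hxw : ⟪x, w⟫ = 0 := by rw [hw, inner_sub_right, inner_smul_right, hxx]; ring
  have hxTw : ⟪x, hessLin f x w⟫ = 0 := by rw [← hS, hμ, inner_smul_left, hxw, mul_zero]
  have hv : v = w + ⟪x, v⟫ • x := by rw [hw]; abel
  have h1 := h w hxw
  have hd1 : (1 : ℝ) ≤ ((d - 1 : ℕ) : ℝ) := by exact_mod_cast (show 1 ≤ d - 1 by omega)
  set s := ⟪x, v⟫
  have e1 : ‖v‖ ^ 2 = ‖w‖ ^ 2 + s ^ 2 := by
    rw [hv, norm_add_sq_real, inner_smul_right, real_inner_comm, hxw, norm_smul, hx,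
      Real.norm_eq_abs, mul_one, sq_abs]
    ring
  have e2 : ⟪v, hessLin f x v⟫ = ⟪w, hessLin f x w⟫ + s ^ 2 * (((d - 1 : ℕ) : ℝ) * c) := by
    rw [hv]
    simp only [map_add, map_smul, hμ, inner_add_left, inner_add_right, inner_smul_left,
      inner_smul_right, RCLike.conj_to_real, hxTw, hxx, real_inner_comm x w, hxw]
    ring
  rw [e1, e2]
  nlinarith [mul_nonneg (mul_nonneg hcn (sq_nonneg s)) (sub_nonneg.mpr hd1)]

/-- At points with negative value, where the radial direction is an eigenvector with too small an
eigenvalue, the condition on the second eigenvalue characterizes local minima. -/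
theorem isLocalMinOn_iff_of_neg (hf : f.IsHomogeneous d) (hgen : IsGeneric d f) (hd : 2 < d)
    (hn : 1 < n) {x : E n} (h0 : value f x < 0) :
    (x ∈ unitSphere n ∧ IsLocalMinOn (value f) (unitSphere n) x) ↔
      x ∈ Theta d f ∧ -‖grad f x‖ ≤ hessEig f x ⟨1, hn⟩ := by
  by_cases hxs : x ∈ unitSphere n
  swap
  · exact ⟨fun h => absurd h.1 hxs, fun h => absurd h.1.1 hxs⟩
  have hx : ‖x‖ = 1 := by simpa [unitSphere] using hxs
  obtain ⟨b, hb⟩ := exists_hess_eigenbasis f x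
  have hS := hessLin_isSymmetric f x
  rw [isLocalMinOn_iff hf hgen hx, mem_Theta_iff hf hx]
  simp only [hxs, true_and]
  refine and_congr_right fun hc => ?_
  have hcn : d * value f x < 0 := mul_neg_of_pos_of_neg (by positivity) h0
  have hnorm : -‖grad f x‖ = d * value f x := by
    rw [hc, norm_smul, hx, mul_one, Real.norm_eq_abs, abs_of_neg hcn, neg_neg]
  have hd1 : (1 : ℝ) < ((d - 1 : ℕ) : ℝ) := by exact_mod_cast (show 1 < d - 1 by omega)
  rw [hnorm, le_second_eigenvalue_iff hS b (hessEig_monotone f x) hb hn (x := x)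
    (by rintro rfl; simp at hx) (hessLin_self_of_critical hf hc) (by nlinarith)]

theorem continuous_value (f : MvPolynomial (Fin n) ℝ) : Continuous (value f) := by
  unfold value
  exact (MvPolynomial.continuous_eval f).comp (by fun_prop)

/-- The local minima are all global iff they share one value, as the minimum is attained. -/
theorem noSpuriousLocalMin_iff (hn : 0 < n) (f : MvPolynomial (Fin n) ℝ) :
    NoSpuriousLocalMin f ↔ ConstantOn f {x | x ∈ unitSphere n ∧
      IsLocalMinOn (value f) (unitSphere n) x} := by
  constructor
  · rintro h x ⟨hx, hxm⟩ y ⟨hy, hym⟩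
    exact le_antisymm (h x hx hxm hy) (h y hy hym hx)
  · intro h x hx hxm
    have : Nonempty (Fin n) := ⟨⟨0, hn⟩⟩
    have hne : (unitSphere n).Nonempty := NormedSpace.sphere_nonempty.mpr zero_le_one
    obtain ⟨y, hy, hym⟩ := (isCompact_sphere (0 : E n) 1).exists_isMinOn hne
      (continuous_value f).continuousOn
    intro w hw
    change value f x ≤ value f w
    rw [h x ⟨hx, hxm⟩ y ⟨hy, hym.localize⟩]
    exact hym hw

theorem value_smul (hf : f.IsHomogeneous d) (r : ℝ) (x : E n) :
    value f (r • x) = r ^ d * value f x := by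
  simp only [value, eval_eq', Finset.mul_sum]
  refine Finset.sum_congr rfl fun m hm => ?_
  have hdeg : ∑ i, m i = d := by
    rw [← Finsupp.degree_eq_sum]
    by_contra hne
    exact mem_support_iff.mp hm (hf.coeff_eq_zero hne)
  simp only [PiLp.smul_apply, smul_eq_mul, mul_pow, Finset.prod_mul_distrib,
    Finset.prod_pow_eq_pow_sum, hdeg]
  ring

theorem exists_mem_sphere_value_neg (hf : f.IsHomogeneous d) (hd : 0 < d)
    (h : ∃ x, value f x < 0) : ∃ x ∈ unitSphere n, value f x < 0 := by
  obtain ⟨x, hx⟩ := h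
  have hx0 : x ≠ 0 := by
    rintro rfl
    have := value_smul hf 0 (0 : E n)
    rw [smul_zero, zero_pow hd.ne', zero_mul] at this
    exact hx.ne this
  have hn : 0 < ‖x‖ := norm_pos_iff.mpr hx0
  refine ⟨‖x‖⁻¹ • x, ?_, ?_⟩
  · simp [unitSphere, norm_smul, hn.ne']
  · rw [value_smul hf]
    exact mul_neg_of_pos_of_neg (by positivity) hx

end SphereForm

theorem corollary3p5 (n d : ℕ) (hn : 2 ≤ n) (hd : 2 < d) :
    (∃ Q : MvPolynomial {m : Fin n →₀ ℕ // m.degree = d} ℝ, Q ≠ 0 ∧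
      ∀ f : MvPolynomial (Fin n) ℝ, f.IsHomogeneous d →
        MvPolynomial.eval (SphereForm.coeffVec d f) Q ≠ 0 → SphereForm.IsGeneric d f) ∧
    ∀ f : MvPolynomial (Fin n) ℝ, f.IsHomogeneous d → SphereForm.IsGeneric d f →
      ((∀ x, 0 ≤ SphereForm.value f x) →
        (SphereForm.NoSpuriousLocalMin f ↔
          SphereForm.ConstantOn f {x | x ∈ SphereForm.Theta d f ∧
            ‖SphereForm.grad f x‖ ≤ SphereForm.hessEig f x ⟨0, by omega⟩})) ∧
      ((∃ x, SphereForm.value f x < 0) →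
        (SphereForm.NoSpuriousLocalMin f ↔
          {x | x ∈ SphereForm.Theta d f ∧ 0 ≤ SphereForm.value f x ∧
            ‖SphereForm.grad f x‖ ≤ SphereForm.hessEig f x ⟨0, by omega⟩} = ∅ ∧
          SphereForm.ConstantOn f {x | x ∈ SphereForm.Theta d f ∧ SphereForm.value f x < 0 ∧
            -‖SphereForm.grad f x‖ ≤ SphereForm.hessEig f x ⟨1, by omega⟩})) := by
  open SphereForm in
  refine ⟨exists_genericity_polynomial n (by omega), fun f hf hgen => ⟨fun hpos => ?_, fun hneg => ?_⟩⟩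
  · rw [noSpuriousLocalMin_iff (by omega)]
    have : {x | x ∈ unitSphere n ∧ IsLocalMinOn (value f) (unitSphere n) x} =
        {x | x ∈ Theta d f ∧ ‖grad f x‖ ≤ hessEig f x ⟨0, by omega⟩} :=
      Set.ext fun x => isLocalMinOn_iff_of_nonneg hf hgen hd.le (by omega) (hpos x)
    rw [this]
  · constructor
    · intro h
      refine ⟨Set.eq_empty_iff_forall_notMem.mpr ?_, ?_⟩
      · rintro x ⟨hx, h0, hx1⟩
        obtain ⟨hxs, hxm⟩ :=
          (isLocalMinOn_iff_of_nonneg hf hgen hd.le (by omega) h0).mpr ⟨hx, hx1⟩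
        obtain ⟨y, hys, hy⟩ := exists_mem_sphere_value_neg hf (by omega) hneg
        have hxy : value f x ≤ value f y := h x hxs hxm hys
        linarith
      · rintro x ⟨hx, hx0, hx1⟩ y ⟨hy, hy0, hy1⟩
        exact (noSpuriousLocalMin_iff (by omega) f).mp h
          x ((isLocalMinOn_iff_of_neg hf hgen hd (by omega) hx0).mpr ⟨hx, hx1⟩)
          y ((isLocalMinOn_iff_of_neg hf hgen hd (by omega) hy0).mpr ⟨hy, hy1⟩)
    · rintro ⟨hempty, hconst⟩
      rw [noSpuriousLocalMin_iff (by omega)]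
      have key : ∀ x, x ∈ unitSphere n ∧ IsLocalMinOn (value f) (unitSphere n) x →
          x ∈ Theta d f ∧ value f x < 0 ∧ -‖grad f x‖ ≤ hessEig f x ⟨1, by omega⟩ := by
        intro x hx
        have hx0 : value f x < 0 := by
          by_contra! h0
          obtain ⟨h1, h2⟩ := (isLocalMinOn_iff_of_nonneg hf hgen hd.le (by omega) h0).mp hx
          exact Set.eq_empty_iff_forall_notMem.mp hempty x ⟨h1, h0, h2⟩
        obtain ⟨h1, h2⟩ := (isLocalMinOn_iff_of_neg hf hgen hd (by omega) hx0).mp hx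
        exact ⟨h1, hx0, h2⟩
      exact fun x hx y hy => hconst x (key x hx) y (key y hy)
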